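/- **Theorem 5 (Information-theoretic recovery lower bounds).** For positive integers $n,k,m$ with $mk\le n$, let $\mathcal K^{\mathsf{con}}_{k,m,n}$ be the set of all unions $\mathsf K=\bigcup_{i=1}^m \mathsf S_i\times \mathsf T_i\subset[n]\times[n]$, where each $\mathsf S_i,\mathsf T_i\subset[n]$ consists of $k$ consecutive integers and the sets $\mathsf S_i\times \mathsf T_i$, $i\in[m]$, are pairwise disjoint. For $\lambda>0$ and $\mathsf K^\star\in\mathcal K^{\mathsf{con}}_{k,m,n}$, let $\mathbb P_{\mathsf K^\star}$ be the law of the random matrix $\mathsf X\in\mathbb R^{n\times n}$ with independent entries, $\mathsf X_{ij}\sim\mathcal N(\lambda,1)$ if $(i,j)\in \mathsf K^\star$ and $\mathsf X_{ij}\sim\mathcal N(0,1)$ otherwise. An estimator is a measurable map $\hat{\mathsf K}$ from $\mathbb R^{n\times n}$ to the subsets of $[n]\times[n]$, and $\mathsf{overlap}(\mathsf K^\star,\hat{\mathsf K})=\mathbb E_{\mathsf K^\star}|\mathsf K^\star\cap\hat{\mathsf K}(\mathsf X)|$. 1. (Exact recovery) There is a universal constant $\mathsf C>0$ such that, for all positive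 integers $n,k,m$ with $mk\le n$ and all $\lambda>0$ with $\lambda<\mathsf C\sqrt{\log m/k}$, $$\inf_{\hat{\mathsf K}}\ \sup_{\mathsf K^\star\in\mathcal K^{\mathsf{con}}_{k,m,n}}\mathbb P_{\mathsf K^\star}\big[\hat{\mathsf K}(\mathsf X)\ne \mathsf K^\star\big]>\frac12,$$ where the infimum ranges over all estimators. 2. (Correlated recovery) Let $k=k_n$, $m=m_n$ be positive integers and $\lambda=\lambda_n>0$, with $m_nk_n\le n$ for all large $n$, $k_n=o(n)$ and $\lambda_n=o(1/k_n)$ as $n\to\infty$. Then for every sequence of estimators $\hat{\mathsf K}_n$ with $|\hat{\mathsf K}_n(\mathsf X)|\le m_nk_n^2$, correlated recovery is impossible: the overlap with a uniformly random planted set satisfies $$\frac1{|\mathcal K^{\mathsf{con}}_{k,m,n}|}\sum_{\mathsf K^\star\in\mathcal K^{\mathsf{con}}_{k,m,n}}\mathsf{overlap}(\mathsf K^\star,\hat{\mathsf K}_n)=o(mk^2),$$ and in particular the worst-case overlap satisfies $\inf_{\mathsf K^\star\in\mathcal K^{\mathsf{con}}_{k,m,n}}\mathsf{overlap}(\mathsf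 K^\star,\hat{\mathsf K}_n)=o(mk^2)$. -/

import Mathlib

open MeasureTheory ProbabilityTheory Filter Asymptotics
open scoped ENNReal BigOperators Topology

/-- The subsets of `[n]` (here `Fin n`) with exactly `k` elements which are consecutive. -/
def consecutiveSets (n k : ℕ) : Set (Finset (Fin n)) :=
  {S | S.card = k ∧ (S : Set (Fin n)).OrdConnected}

open Classical in
/-- The family of all unions of `m` pairwise disjoint `k × k` submatrices of an `n × n` matrix,
each with consecutive rows and consecutive columns. -/
noncomputable def consecutiveFamily (n k m : ℕ) : Finset (Finset (Fin n × Fin n)) :=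
  Finset.univ.filter fun K =>
    ∃ S T : Fin m → Finset (Fin n),
      (∀ i, S i ∈ consecutiveSets n k ∧ T i ∈ consecutiveSets n k) ∧
      (∀ i j, i ≠ j → Disjoint (S i ×ˢ T i) (S j ×ˢ T j)) ∧
      K = Finset.univ.biUnion fun i => S i ×ˢ T i

/-- The law of the observed `n × n` matrix when the planted set is `K`: the entries are independent,
`N(lam, 1)` on `K` and `N(0, 1)` off `K`. -/
noncomputable def plantedLaw {n : ℕ} (lam : ℝ) (K : Finset (Fin n × Fin n)) :
    Measure (Fin n × Fin n → ℝ) :=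
  Measure.pi fun p => gaussianReal (if p ∈ K then lam else 0) 1

/-- An estimator of the planted set: a measurable function of the observed matrix with values in
the (finite) collection of all subsets of `[n] × [n]`. -/
def IsEstimator {n : ℕ} (Khat : (Fin n × Fin n → ℝ) → Finset (Fin n × Fin n)) : Prop :=
  Measurable[_, ⊤] Khat

/-- The overlap of the planted set `K` and the estimator `Khat`: the expected size of their
intersection when the observed matrix is drawn with planted set `K`. -/
noncomputable def overlap {n : ℕ} (lam : ℝ) (K : Finset (Fin n × Fin n))
    (Khat : (Fin n × Fin n → ℝ) → Finset (Fin n × Fin n)) : ℝ :=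
  ∫ X, ((K ∩ Khat X).card : ℝ) ∂(plantedLaw lam K)

/-! Both parts compare planted laws through Gaussian likelihood ratios, whose moments depend only on
`lam ^ 2` times the size of the symmetric difference of the planted sets. Exact recovery: a band of
`m` adjacent blocks and its `m` variants with one block moved down by a row form `m + 1` hypotheses.
Each variant differs from the band in at most `2 * k` entries, so when `lam ^ 2 * k` is a small
multiple of `log m` the fourth moments of the likelihood ratios are at most a small power of `m`.
The events of correct recovery are disjoint under the reference law, so their probabilities under
the true laws cannot all be large (`sum_plantedLaw_real_eq_le`, `error_probability_ge`). Correlated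
recovery: deleting one block changes at most `k ^ 2` entries, hence costs a relative error of order
`k * lam` (`overlap_blockUnion_le`). The deleted block is then uniform among the free positions
given the others (`sum_packings_erase`). There are at least `n ^ 2 / 2` such positions, and each
entry of the estimate lies in at most `k ^ 2` blocks, so the remaining overlap is a fraction of
order `k / n` of the maximum. -/

/-! ### Gaussian likelihood ratios and change of measure -/

/-- The density of `N(a + d, 1)` with respect to `N(a, 1)`. -/
noncomputable def gaussianShiftRatio (a d x : ℝ) : ℝ := Real.exp (d * (x - a) - d ^ 2 / 2)

lemma gaussianShiftRatio_pos (a d x : ℝ) : 0 < gaussianShiftRatio a d x := Real.exp_pos _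

lemma measurable_gaussianShiftRatio (a d : ℝ) : Measurable (gaussianShiftRatio a d) := by
  unfold gaussianShiftRatio; fun_prop

lemma gaussianReal_add_eq_withDensity (a d : ℝ) :
    gaussianReal (a + d) 1 =
      (gaussianReal a 1).withDensity fun x => ENNReal.ofReal (gaussianShiftRatio a d x) := by
  rw [gaussianReal_of_var_ne_zero _ one_ne_zero, gaussianReal_of_var_ne_zero _ one_ne_zero,
    ← withDensity_mul _ (measurable_gaussianPDF _ _)
      (measurable_gaussianShiftRatio a d).ennreal_ofReal]
  congr 1
  ext x
  simp only [Pi.mul_apply, gaussianPDF]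
  rw [← ENNReal.ofReal_mul (gaussianPDFReal_nonneg _ _ _)]
  congr 1
  simp only [gaussianPDFReal, gaussianShiftRatio, mul_assoc]
  rw [← Real.exp_add]
  congr 2
  simp
  ring

lemma gaussianShiftRatio_pow (a d x : ℝ) (j : ℕ) :
    gaussianShiftRatio a d x ^ j =
      Real.exp (j * (-(d * a) - d ^ 2 / 2)) * Real.exp (j * d * x) := by
  rw [gaussianShiftRatio, ← Real.exp_nat_mul, ← Real.exp_add]
  congr 1
  ring

lemma integrable_gaussianShiftRatio_pow (a d : ℝ) (j : ℕ) :
    Integrable (fun x => gaussianShiftRatio a d x ^ j) (gaussianReal a 1) := by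
  simp_rw [gaussianShiftRatio_pow]
  exact (integrable_exp_mul_gaussianReal _).const_mul _

lemma integral_gaussianShiftRatio_pow (a d : ℝ) (j : ℕ) :
    ∫ x, gaussianShiftRatio a d x ^ j ∂(gaussianReal a 1) =
      Real.exp (((j : ℝ) ^ 2 - j) / 2 * d ^ 2) := by
  simp_rw [gaussianShiftRatio_pow]
  rw [integral_const_mul]
  have h := congrFun (mgf_fun_id_gaussianReal (μ := a) (v := 1)) (j * d)
  rw [mgf] at h
  rw [h, ← Real.exp_add]
  congr 1
  push_cast
  ring

section Pi

variable {ι : Type*} [Fintype ι]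

lemma pi_gaussianReal_add_eq_withDensity (a d : ι → ℝ) :
    Measure.pi (fun i => gaussianReal (a i + d i) 1) =
      (Measure.pi fun i => gaussianReal (a i) 1).withDensity
        fun x => ENNReal.ofReal (∏ i, gaussianShiftRatio (a i) (d i) (x i)) := by
  have hint : ∀ i, Integrable (gaussianShiftRatio (a i) (d i)) (gaussianReal (a i) 1) := fun i => by
    simpa using integrable_gaussianShiftRatio_pow (a i) (d i) 1
  refine Measure.pi_eq fun s hs => ?_
  rw [withDensity_apply _ (MeasurableSet.univ_pi hs), Measure.restrict_pi_pi,
    ← ofReal_integral_eq_lintegral_ofReal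
      (Integrable.fintype_prod_dep fun i => (hint i).restrict)
      (ae_of_all _ fun x => Finset.prod_nonneg fun i _ => (gaussianShiftRatio_pos _ _ _).le),
    integral_fintype_prod_eq_prod (𝕜 := ℝ),
    ENNReal.ofReal_prod_of_nonneg fun i _ =>
      integral_nonneg fun x => (gaussianShiftRatio_pos _ _ _).le]
  refine Finset.prod_congr rfl fun i _ => ?_
  rw [gaussianReal_add_eq_withDensity, withDensity_apply _ (hs i),
    ofReal_integral_eq_lintegral_ofReal (hint i).restrict
      (ae_of_all _ fun x => (gaussianShiftRatio_pos _ _ _).le)]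

end Pi

instance {n : ℕ} (lam : ℝ) (K : Finset (Fin n × Fin n)) :
    IsProbabilityMeasure (plantedLaw lam K) := by
  unfold plantedLaw; infer_instance

/-- The likelihood ratio of the planted law of `K'` with respect to that of `K`, together with
its moments. -/
lemma exists_likelihoodRatio {n : ℕ} (lam : ℝ) (K K' : Finset (Fin n × Fin n)) :
    ∃ L : (Fin n × Fin n → ℝ) → ℝ, Measurable L ∧ (∀ x, 0 ≤ L x) ∧
      (∀ j : ℕ, Integrable (fun x => L x ^ j) (plantedLaw lam K)) ∧
      (∀ j : ℕ, ∫ x, L x ^ j ∂(plantedLaw lam K) =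
        Real.exp (((j : ℝ) ^ 2 - j) / 2 * (lam ^ 2 * (symmDiff K K').card))) ∧
      ∀ f : (Fin n × Fin n → ℝ) → ℝ,
        ∫ x, f x ∂(plantedLaw lam K') = ∫ x, L x * f x ∂(plantedLaw lam K) := by
  classical
  set a : Fin n × Fin n → ℝ := fun p => if p ∈ K then lam else 0 with ha
  set d : Fin n × Fin n → ℝ := fun p => (if p ∈ K' then lam else 0) - a p with hd
  have hmeas : Measurable fun x : Fin n × Fin n → ℝ =>
      ∏ p, gaussianShiftRatio (a p) (d p) (x p) :=
    Finset.measurable_prod _ fun p _ =>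
      (measurable_gaussianShiftRatio _ _).comp (measurable_pi_apply p)
  have hnn : ∀ x : Fin n × Fin n → ℝ, 0 ≤ ∏ p, gaussianShiftRatio (a p) (d p) (x p) := fun x =>
    Finset.prod_nonneg fun i _ => (gaussianShiftRatio_pos _ _ _).le
  refine ⟨fun x => ∏ p, gaussianShiftRatio (a p) (d p) (x p), hmeas, hnn, fun j => ?_, fun j => ?_,
    fun f => ?_⟩
  · simp_rw [← Finset.prod_pow]
    exact Integrable.fintype_prod_dep fun p => integrable_gaussianShiftRatio_pow (a p) (d p) j
  · simp_rw [← Finset.prod_pow]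
    unfold plantedLaw
    rw [integral_fintype_prod_eq_prod (𝕜 := ℝ)
      (fun p y => gaussianShiftRatio (a p) (d p) y ^ j)]
    have hsum : ∑ p, d p ^ 2 = lam ^ 2 * (symmDiff K K').card := by
      rw [Finset.card_eq_sum_ones, Nat.cast_sum, Finset.mul_sum,
        ← Finset.sum_subset (Finset.subset_univ (symmDiff K K'))]
      · refine Finset.sum_congr rfl fun p hp => ?_
        rcases Finset.mem_symmDiff.1 hp with ⟨h, h'⟩ | ⟨h, h'⟩ <;> simp [hd, ha, h, h']
      · intro p _ hp
        by_cases h : p ∈ K <;> by_cases h' : p ∈ K' <;>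
          simp_all [Finset.mem_symmDiff]
    rw [← hsum, Finset.mul_sum, Real.exp_sum]
    exact Finset.prod_congr rfl fun p _ => integral_gaussianShiftRatio_pow (a p) (d p) j
  · have h : plantedLaw lam K' = (plantedLaw lam K).withDensity
        fun x => ENNReal.ofReal (∏ p, gaussianShiftRatio (a p) (d p) (x p)) := by
      have := pi_gaussianReal_add_eq_withDensity a d
      simpa [hd, ha, plantedLaw] using this
    rw [h, integral_withDensity_eq_integral_toReal_smul hmeas.ennreal_ofReal
      (ae_of_all _ fun x => ENNReal.ofReal_lt_top)]
    simp only [smul_eq_mul, ENNReal.toReal_ofReal (hnn _)]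

/-- Changing the planted set in few entries changes the mean of a bounded function little. -/
lemma integral_plantedLaw_le_add {n : ℕ} {lam t c : ℝ} {K K' : Finset (Fin n × Fin n)}
    (ht : 0 < t) (ht1 : t ≤ 1) (hK : lam ^ 2 * (symmDiff K K').card ≤ t ^ 2)
    {f : (Fin n × Fin n → ℝ) → ℝ} (hf : Measurable f) (hf0 : ∀ x, 0 ≤ f x) (hfc : ∀ x, f x ≤ c) :
    ∫ x, f x ∂(plantedLaw lam K') ≤ ∫ x, f x ∂(plantedLaw lam K) + c * (2 * t) := by
  obtain ⟨L, hLm, hL0, hLi, hLv, hLf⟩ := exists_likelihoodRatio lam K K'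
  have hc : 0 ≤ c := (hf0 0).trans (hfc 0)
  have hfi : Integrable f (plantedLaw lam K) :=
    Integrable.of_bound hf.aestronglyMeasurable c
      (ae_of_all _ fun x => by rw [Real.norm_of_nonneg (hf0 x)]; exact hfc x)
  have h1 := hLi 1
  have h2 := hLi 2
  simp only [pow_one] at h1
  have hLfi : Integrable (fun x => L x * f x) (plantedLaw lam K) :=
    h1.mul_bdd (c := c) hf.aestronglyMeasurable
      (ae_of_all _ fun x => by rw [Real.norm_of_nonneg (hf0 x)]; exact hfc x)
  -- AM-GM: `L - 1 ≤ (t + (L - 1) ^ 2 / t) / 2`, which is nonnegative and so may be multiplied by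
  -- `c` instead of `f x`.
  have hpt : ∀ x, L x * f x ≤ f x + c * ((t + (L x ^ 2 - 2 * L x + 1) / t) / 2) := by
    intro x
    have hA : L x - 1 ≤ (t + (L x ^ 2 - 2 * L x + 1) / t) / 2 := by
      rw [le_div_iff₀ two_pos, ← sub_nonneg]
      have : t + (L x ^ 2 - 2 * L x + 1) / t - (L x - 1) * 2 = (t - (L x - 1)) ^ 2 / t := by
        field_simp; ring
      rw [this]; positivity
    have hB : 0 ≤ (t + (L x ^ 2 - 2 * L x + 1) / t) / 2 := by
      have : L x ^ 2 - 2 * L x + 1 = (L x - 1) ^ 2 := by ring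
      rw [this]; positivity
    nlinarith [mul_le_mul_of_nonneg_right hA (hf0 x), mul_le_mul_of_nonneg_left (hfc x) hB]
  rw [hLf f]
  have hq₀ : Integrable (fun x => L x ^ 2 - 2 * L x) (plantedLaw lam K) :=
    h2.sub (h1.const_mul 2)
  have hq : Integrable (fun x => L x ^ 2 - 2 * L x + 1) (plantedLaw lam K) :=
    hq₀.add (integrable_const 1)
  have hr : Integrable (fun x => t + (L x ^ 2 - 2 * L x + 1) / t) (plantedLaw lam K) :=
    (integrable_const t).add (hq.div_const t)
  have hgi : Integrable (fun x => c * ((t + (L x ^ 2 - 2 * L x + 1) / t) / 2))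
      (plantedLaw lam K) := (hr.div_const 2).const_mul c
  refine (integral_mono hLfi (hfi.add hgi) hpt).trans ?_
  simp only [Pi.add_apply]
  have hv1 := hLv 1
  simp only [pow_one] at hv1
  rw [integral_add hfi hgi, integral_const_mul, integral_div,
    integral_add (integrable_const t) (hq.div_const t), integral_div,
    integral_add hq₀ (integrable_const 1), integral_sub h2 (h1.const_mul 2),
    integral_const_mul, hLv 2, hv1]
  simp only [integral_const, probReal_univ, smul_eq_mul, one_mul]
  norm_num
  set y := lam ^ 2 * ((symmDiff K K').card : ℝ) with hy
  have hexp : Real.exp y - 1 ≤ 2 * t ^ 2 := by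
    have h0 : 0 ≤ y := by positivity
    have := Real.abs_exp_sub_one_le (x := y) (by rw [abs_of_nonneg h0]; nlinarith)
    rw [abs_of_nonneg h0] at this
    linarith [le_abs_self (Real.exp y - 1)]
  refine mul_le_mul_of_nonneg_left ?_ hc
  have : (Real.exp y - 2 + 1) / t ≤ 2 * t := by
    rw [div_le_iff₀ ht]; nlinarith
  linarith

/-- A change of measure for events, by Young's inequality with exponent four. -/
lemma plantedLaw_real_le_young {n : ℕ} {lam t : ℝ} {K K' : Finset (Fin n × Fin n)} (ht : 0 < t)
    {A : Set (Fin n × Fin n → ℝ)} (hA : MeasurableSet A) :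
    (plantedLaw lam K').real A ≤ 3 * t / 4 * (plantedLaw lam K).real A +
      Real.exp (6 * (lam ^ 2 * (symmDiff K K').card)) / (4 * t ^ 3) := by
  obtain ⟨L, hLm, hL0, hLi, hLv, hLf⟩ := exists_likelihoodRatio lam K K'
  have hv := hLv 4
  norm_num at hv
  have hpt : ∀ x, L x * A.indicator 1 x ≤ 3 * t / 4 * A.indicator 1 x + L x ^ 4 / (4 * t ^ 3) := by
    intro x
    by_cases hx : x ∈ A
    · simp only [Set.indicator_of_mem hx, Pi.one_apply, mul_one]
      rw [← sub_nonneg]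
      -- The difference is a quartic in `L` with a double zero at `t`, the equality case of Young's
      -- inequality.
      have : 3 * t / 4 + L x ^ 4 / (4 * t ^ 3) - L x =
          (L x - t) ^ 2 * (L x ^ 2 + 2 * t * L x + 3 * t ^ 2) / (4 * t ^ 3) := by
        field_simp; ring
      rw [this]
      have := hL0 x
      positivity
    · simp only [Set.indicator_of_notMem hx, mul_zero, zero_add]
      positivity
  have hind : Integrable (A.indicator (1 : (Fin n × Fin n → ℝ) → ℝ)) (plantedLaw lam K) :=
    (integrable_const (1 : ℝ)).indicator hA
  have h1 := hLi 1
  simp only [pow_one] at h1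
  have hLA : Integrable (fun x => L x * A.indicator (1 : (Fin n × Fin n → ℝ) → ℝ) x)
      (plantedLaw lam K) := by
    refine (h1.indicator hA).congr (ae_of_all _ fun x => ?_)
    by_cases hx : x ∈ A <;> simp [hx]
  rw [← integral_indicator_one hA, ← integral_indicator_one hA, hLf]
  refine (integral_mono hLA ((hind.const_mul _).add ((hLi 4).div_const _)) hpt).trans_eq ?_
  simp only [Pi.add_apply]
  rw [integral_add (hind.const_mul _) ((hLi 4).div_const _), integral_const_mul, integral_div, hv]

/-! ### Blocks, corners and packings -/

/-- The `k` consecutive elements of `Fin n` from `a` on (fewer if they do not fit). -/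
def finInterval (n k a : ℕ) : Finset (Fin n) :=
  Finset.univ.filter fun i => a ≤ (i : ℕ) ∧ (i : ℕ) < a + k

lemma mem_finInterval {n k a : ℕ} {i : Fin n} :
    i ∈ finInterval n k a ↔ a ≤ (i : ℕ) ∧ (i : ℕ) < a + k := by
  simp [finInterval]

lemma map_finInterval {n k a : ℕ} (h : a + k ≤ n) :
    (finInterval n k a).map Fin.valEmbedding = Finset.Ico a (a + k) := by
  ext x
  simp only [Finset.mem_map, mem_finInterval, Fin.valEmbedding_apply, Finset.mem_Ico]
  exact ⟨fun ⟨i, hi, hx⟩ => hx ▸ hi, fun hx => ⟨⟨x, by omega⟩, hx, rfl⟩⟩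

lemma card_finInterval {n k a : ℕ} (h : a + k ≤ n) : (finInterval n k a).card = k := by
  rw [← Finset.card_map Fin.valEmbedding, map_finInterval h]
  simp

lemma card_finInterval_le (n k a : ℕ) : (finInterval n k a).card ≤ k := by
  rw [← Finset.card_map Fin.valEmbedding]
  refine (Finset.card_le_card (t := Finset.Ico a (a + k)) fun x hx => ?_).trans (by simp)
  simp only [Finset.mem_map, mem_finInterval, Fin.valEmbedding_apply] at hx
  obtain ⟨i, hi, rfl⟩ := hx
  simpa using hi

lemma finInterval_mem_consecutiveSets {n k a : ℕ} (h : a + k ≤ n) :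
    finInterval n k a ∈ consecutiveSets n k := by
  refine ⟨card_finInterval h, ⟨fun x hx y hy z hz => ?_⟩⟩
  simp only [Finset.mem_coe, mem_finInterval] at *
  have h1 : (x : ℕ) ≤ z := hz.1
  have h2 : (z : ℕ) ≤ y := hz.2
  omega

lemma exists_eq_finInterval {n k : ℕ} (hk : 0 < k) {S : Finset (Fin n)}
    (hS : S ∈ consecutiveSets n k) : ∃ a, a + k ≤ n ∧ S = finInterval n k a := by
  obtain ⟨hcard, hord⟩ := hS
  have hne : S.Nonempty := Finset.card_pos.1 (by omega)
  have hIcc : S = Finset.Icc (S.min' hne) (S.max' hne) := by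
    ext x
    rw [Finset.mem_Icc]
    exact ⟨fun hx => ⟨S.min'_le x hx, S.le_max' x hx⟩, fun hx =>
      hord.out (S.min'_mem hne) (S.max'_mem hne) hx⟩
  have hc := congrArg Finset.card hIcc
  rw [hcard, Fin.card_Icc] at hc
  have hlt := (S.max' hne).2
  refine ⟨S.min' hne, by omega, ?_⟩
  ext x
  rw [mem_finInterval]
  constructor
  · intro hx
    have h1 : (S.min' hne : ℕ) ≤ x := S.min'_le x hx
    have h2 : (x : ℕ) ≤ S.max' hne := S.le_max' x hx
    omega
  · rintro ⟨h1, h2⟩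
    rw [hIcc, Finset.mem_Icc, Fin.le_def, Fin.le_def]
    omega

/-- The `k × k` block of consecutive rows and columns with upper left corner `c`. -/
def block (n k : ℕ) (c : ℕ × ℕ) : Finset (Fin n × Fin n) :=
  finInterval n k c.1 ×ˢ finInterval n k c.2

lemma mem_block {n k : ℕ} {c : ℕ × ℕ} {p : Fin n × Fin n} :
    p ∈ block n k c ↔
      (c.1 ≤ (p.1 : ℕ) ∧ (p.1 : ℕ) < c.1 + k) ∧ (c.2 ≤ (p.2 : ℕ) ∧ (p.2 : ℕ) < c.2 + k) := by
  rw [block, Finset.mem_product, mem_finInterval, mem_finInterval]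

lemma card_block_le (n k : ℕ) (c : ℕ × ℕ) : (block n k c).card ≤ k ^ 2 := by
  rw [block, Finset.card_product, sq]
  exact Nat.mul_le_mul (card_finInterval_le _ _ _) (card_finInterval_le _ _ _)

/-- The upper left corners of the blocks that fit into the matrix. -/
def corners (n k : ℕ) : Finset (ℕ × ℕ) := Finset.range (n + 1 - k) ×ˢ Finset.range (n + 1 - k)

lemma mem_corners {n k : ℕ} {c : ℕ × ℕ} :
    c ∈ corners n k ↔ c.1 + k ≤ n ∧ c.2 + k ≤ n := by
  simp only [corners, Finset.mem_product, Finset.mem_range]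
  omega

lemma exists_corner_mem_block {n k : ℕ} {c : ℕ × ℕ} (hk : 0 < k) (hc : c ∈ corners n k) :
    ∃ p ∈ block n k c, (p.1 : ℕ) = c.1 ∧ (p.2 : ℕ) = c.2 := by
  rw [mem_corners] at hc
  exact ⟨(⟨c.1, by omega⟩, ⟨c.2, by omega⟩), by rw [mem_block]; simp; omega, rfl, rfl⟩

/-- The sets of `m` corners whose blocks are pairwise disjoint. -/
def packings (n k m : ℕ) : Finset (Finset (ℕ × ℕ)) :=
  ((corners n k).powersetCard m).filter fun D =>
    ∀ c ∈ D, ∀ c' ∈ D, c ≠ c' → Disjoint (block n k c) (block n k c')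

lemma mem_packings {n k m : ℕ} {D : Finset (ℕ × ℕ)} :
    D ∈ packings n k m ↔ (D ⊆ corners n k ∧ D.card = m) ∧
      ∀ c ∈ D, ∀ c' ∈ D, c ≠ c' → Disjoint (block n k c) (block n k c') := by
  rw [packings, Finset.mem_filter, Finset.mem_powersetCard]

/-- The union of the blocks with corners in `D`. -/
def blockUnion (n k : ℕ) (D : Finset (ℕ × ℕ)) : Finset (Fin n × Fin n) :=
  D.biUnion (block n k)

/-- A set of disjoint blocks is determined by its union: the first corner (in lexicographic
order) on which two packings differ would be covered twice. -/
lemma blockUnion_injOn {n k m : ℕ} (hk : 0 < k) :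
    Set.InjOn (blockUnion n k) (packings n k m : Set (Finset (ℕ × ℕ))) := by
  have key : ∀ D ∈ packings n k m, ∀ D' ∈ packings n k m, blockUnion n k D = blockUnion n k D' →
      ∀ c ∈ D, c ∉ D' → ∃ c' ∈ D', c' ∉ D ∧ toLex c' < toLex c := by
    intro D hD D' hD' hU c hc hc'
    rw [mem_packings] at hD hD'
    obtain ⟨p, hp, hp1, hp2⟩ := exists_corner_mem_block hk (hD.1.1 hc)
    have hpU : p ∈ blockUnion n k D' := hU ▸ Finset.mem_biUnion.2 ⟨c, hc, hp⟩
    obtain ⟨e, he, hpe⟩ := Finset.mem_biUnion.1 hpU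
    have hne : e ≠ c := fun h => hc' (h ▸ he)
    refine ⟨e, he, fun heD => Finset.disjoint_left.1 (hD.2 e heD c hc hne) hpe hp, ?_⟩
    rw [mem_block] at hpe
    rw [Prod.Lex.toLex_lt_toLex]
    by_cases h : e.1 = c.1
    · refine Or.inr ⟨h, lt_of_le_of_ne (by omega) fun h2 => hne (Prod.ext h h2)⟩
    · exact Or.inl (by omega)
  have aux : ∀ D ∈ packings n k m, ∀ D' ∈ packings n k m, blockUnion n k D = blockUnion n k D' →
      ∀ x : ℕ ×ₗ ℕ, (ofLex x ∈ D ↔ ofLex x ∈ D') := by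
    intro D hD D' hD' hU x
    induction x using WellFoundedLT.induction with
    | ind x ih =>
      by_contra hx
      rcases not_iff.1 hx with hx
      by_cases hxD : ofLex x ∈ D
      · obtain ⟨c', h1, h2, h3⟩ := key D hD D' hD' hU _ hxD (by tauto)
        exact h2 ((ih (toLex c') h3).2 h1)
      · obtain ⟨c', h1, h2, h3⟩ := key D' hD' D hD hU.symm _ (by tauto) hxD
        exact h2 ((ih (toLex c') h3).1 h1)
  intro D hD D' hD' hU
  ext c
  exact aux D hD D' hD' hU (toLex c)

/-- Nonempty disjoint blocks have distinct corners, so indexed families of blocks reduce to sets of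
corners. Together with `blockUnion_injOn` this turns a uniform planted set into a uniform packing.
-/
lemma consecutiveFamily_eq_image {n k m : ℕ} (hk : 0 < k) :
    consecutiveFamily n k m = (packings n k m).image (blockUnion n k) := by
  ext K
  simp only [consecutiveFamily, Finset.mem_filter, Finset.mem_univ, true_and, Finset.mem_image,
    mem_packings]
  constructor
  · rintro ⟨S, T, hST, hdisj, rfl⟩
    choose a ha hSa using fun i => exists_eq_finInterval hk (hST i).1
    choose b hb hTb using fun i => exists_eq_finInterval hk (hST i).2
    obtain rfl : S = fun i => finInterval n k (a i) := funext hSa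
    obtain rfl : T = fun i => finInterval n k (b i) := funext hTb
    have hcor : ∀ i, (a i, b i) ∈ corners n k := fun i => mem_corners.2 ⟨ha i, hb i⟩
    have hinj : Function.Injective fun i => (a i, b i) := by
      intro i j hij
      by_contra hne
      obtain ⟨p, hp, -⟩ := exists_corner_mem_block hk (hcor i)
      refine Finset.disjoint_left.1 (hdisj i j hne) hp ?_
      have h' : (a i, b i) = (a j, b j) := hij
      rw [h'] at hp
      exact hp
    refine ⟨Finset.univ.image fun i => (a i, b i), ⟨⟨?_, ?_⟩, ?_⟩, ?_⟩
    · intro c hc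
      obtain ⟨i, -, rfl⟩ := Finset.mem_image.1 hc
      exact hcor i
    · rw [Finset.card_image_of_injective _ hinj, Finset.card_univ, Fintype.card_fin]
    · intro c hc c' hc' hne
      obtain ⟨i, -, rfl⟩ := Finset.mem_image.1 hc
      obtain ⟨j, -, rfl⟩ := Finset.mem_image.1 hc'
      exact hdisj i j fun h => hne (by rw [h])
    · rw [blockUnion, Finset.image_biUnion]
      rfl
  · rintro ⟨D, ⟨⟨hsub, hcard⟩, hdisj⟩, rfl⟩
    have e := (D.equivFinOfCardEq hcard).symm
    refine ⟨fun i => finInterval n k (e i).1.1, fun i => finInterval n k (e i).1.2, fun i => ?_,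
      fun i j hij => ?_, ?_⟩
    · have := mem_corners.1 (hsub (e i).2)
      exact ⟨finInterval_mem_consecutiveSets this.1, finInterval_mem_consecutiveSets this.2⟩
    · exact hdisj _ (e i).2 _ (e j).2 fun h => hij (e.injective (Subtype.ext h))
    · ext p
      simp only [blockUnion, Finset.mem_biUnion, Finset.mem_univ, true_and]
      constructor
      · rintro ⟨c, hc, hp⟩
        exact ⟨e.symm ⟨c, hc⟩, by rw [Equiv.apply_symm_apply]; exact hp⟩
      · rintro ⟨i, hp⟩
        exact ⟨(e i).1, (e i).2, hp⟩

/-! ### Counting free positions and covered entries -/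

/-- The corners of the blocks that are disjoint from all blocks with corners in `E`. -/
def freeCorners (n k : ℕ) (E : Finset (ℕ × ℕ)) : Finset (ℕ × ℕ) :=
  (corners n k).filter fun c => ∀ e ∈ E, Disjoint (block n k c) (block n k e)

lemma mem_freeCorners {n k : ℕ} {E : Finset (ℕ × ℕ)} {c : ℕ × ℕ} :
    c ∈ freeCorners n k E ↔
      c ∈ corners n k ∧ ∀ e ∈ E, Disjoint (block n k c) (block n k e) := by
  rw [freeCorners, Finset.mem_filter]

lemma notMem_of_mem_freeCorners {n k : ℕ} {E : Finset (ℕ × ℕ)} {c : ℕ × ℕ} (hk : 0 < k)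
    (hc : c ∈ freeCorners n k E) : c ∉ E := by
  intro h
  rw [mem_freeCorners] at hc
  obtain ⟨p, hp, -⟩ := exists_corner_mem_block hk hc.1
  exact Finset.disjoint_left.1 (hc.2 c h) hp hp

/-- Removing a block from a packing and adding a free block to a packing are inverse. -/
lemma sum_packings_erase {M : Type*} [AddCommMonoid M] {n k m : ℕ} (hk : 0 < k)
    (g : Finset (ℕ × ℕ) → ℕ × ℕ → M) :
    ∑ D ∈ packings n k (m + 1), ∑ c ∈ D, g (D.erase c) c =
      ∑ E ∈ packings n k m, ∑ c ∈ freeCorners n k E, g E c := by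
  rw [Finset.sum_sigma', Finset.sum_sigma']
  refine Finset.sum_bij' (fun x _ => ⟨x.1.erase x.2, x.2⟩) (fun x _ => ⟨insert x.2 x.1, x.2⟩)
    ?_ ?_ ?_ ?_ ?_
  · rintro ⟨D, c⟩ h
    simp only [Finset.mem_sigma, mem_packings, mem_freeCorners] at h ⊢
    obtain ⟨⟨⟨hsub, hcard⟩, hdisj⟩, hc⟩ := h
    refine ⟨⟨⟨(Finset.erase_subset _ _).trans hsub, ?_⟩, ?_⟩, hsub hc, ?_⟩
    · rw [Finset.card_erase_of_mem hc, hcard]; simp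
    · exact fun a ha b hb => hdisj a (Finset.mem_of_mem_erase ha) b (Finset.mem_of_mem_erase hb)
    · exact fun e he => hdisj c hc e (Finset.mem_of_mem_erase he) (Finset.ne_of_mem_erase he).symm
  · rintro ⟨E, c⟩ h
    simp only [Finset.mem_sigma] at h
    have hn := notMem_of_mem_freeCorners hk h.2
    simp only [Finset.mem_sigma, mem_packings, mem_freeCorners] at h ⊢
    obtain ⟨⟨⟨hsub, hcard⟩, hdisj⟩, hc, hfree⟩ := h
    refine ⟨⟨⟨Finset.insert_subset hc hsub, ?_⟩, ?_⟩, Finset.mem_insert_self _ _⟩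
    · rw [Finset.card_insert_of_notMem hn, hcard]
    · intro a ha b hb hab
      rcases Finset.mem_insert.1 ha with ha' | ha' <;>
        rcases Finset.mem_insert.1 hb with hb' | hb'
      · exact absurd (ha'.trans hb'.symm) hab
      · exact ha' ▸ hfree b hb'
      · exact hb' ▸ (hfree a ha').symm
      · exact hdisj a ha' b hb' hab
  · rintro ⟨D, c⟩ h
    rw [Finset.mem_sigma] at h
    simp [Finset.insert_erase h.2]
  · rintro ⟨E, c⟩ h
    rw [Finset.mem_sigma] at h
    simp [Finset.erase_insert (notMem_of_mem_freeCorners hk h.2)]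
  · rintro ⟨D, c⟩ _
    rfl

/-- Two blocks can meet only if their corners differ by less than `k` in each coordinate, so each `e
∈ E` excludes at most `(2 * k) ^ 2` corners. Truncated subtraction at the boundary only shrinks the
excluded square. -/
lemma card_freeCorners_ge {n k : ℕ} (hk : 0 < k) (E : Finset (ℕ × ℕ)) :
    (n + 1 - k) ^ 2 ≤ (freeCorners n k E).card + E.card * (2 * k) ^ 2 := by
  have hsub : corners n k ⊆ freeCorners n k E ∪ E.biUnion fun e =>
      Finset.Ico (e.1 + 1 - k) (e.1 + k) ×ˢ Finset.Ico (e.2 + 1 - k) (e.2 + k) := by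
    intro c hc
    by_cases h : c ∈ freeCorners n k E
    · exact Finset.mem_union_left _ h
    · refine Finset.mem_union_right _ ?_
      rw [mem_freeCorners] at h
      push Not at h
      obtain ⟨e, he, hne⟩ := h hc
      obtain ⟨p, hp, hp'⟩ := Finset.not_disjoint_iff.1 hne
      rw [mem_block] at hp hp'
      refine Finset.mem_biUnion.2 ⟨e, he, ?_⟩
      simp only [Finset.mem_product, Finset.mem_Ico]
      omega
  calc (n + 1 - k) ^ 2 = (corners n k).card := by
        rw [corners, Finset.card_product, Finset.card_range, sq]
    _ ≤ _ := Finset.card_le_card hsub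
    _ ≤ _ := Finset.card_union_le _ _
    _ ≤ _ := by
        refine Nat.add_le_add_left (Finset.card_biUnion_le_card_mul _ _ _ fun e _ => ?_) _
        rw [Finset.card_product, Nat.card_Ico, Nat.card_Ico, sq]
        exact Nat.mul_le_mul (by omega) (by omega)

/-- Double counting: an entry belongs to at most `k ^ 2` blocks. -/
lemma sum_card_block_inter_le (n k : ℕ) (A : Finset (ℕ × ℕ)) (F : Finset (Fin n × Fin n)) :
    ∑ c ∈ A, (block n k c ∩ F).card ≤ F.card * k ^ 2 := by
  have h : ∀ c, (block n k c ∩ F).card = ∑ p ∈ F, if p ∈ block n k c then 1 else 0 := by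
    intro c
    rw [Finset.inter_comm, ← Finset.filter_mem_eq_inter, Finset.card_filter]
  simp_rw [h]
  rw [Finset.sum_comm, ← smul_eq_mul]
  refine Finset.sum_le_card_nsmul _ _ _ fun p _ => ?_
  rw [← Finset.card_filter]
  refine (Finset.card_le_card (t := Finset.Ico ((p.1 : ℕ) + 1 - k) (p.1 + 1) ×ˢ
    Finset.Ico ((p.2 : ℕ) + 1 - k) (p.2 + 1)) fun c hc => ?_).trans ?_
  · have := mem_block.1 (Finset.mem_filter.1 hc).2
    simp only [Finset.mem_product, Finset.mem_Ico]
    omega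
  · rw [Finset.card_product, Nat.card_Ico, Nat.card_Ico, sq]
    exact Nat.mul_le_mul (by omega) (by omega)

lemma card_symmDiff_blockUnion_erase_le {n k : ℕ} {D : Finset (ℕ × ℕ)} {c : ℕ × ℕ} :
    (symmDiff (blockUnion n k (D.erase c)) (blockUnion n k D)).card ≤ k ^ 2 := by
  refine (Finset.card_le_card fun p hp => ?_).trans (card_block_le n k c)
  rw [Finset.mem_symmDiff] at hp
  simp only [blockUnion, Finset.mem_biUnion, Finset.mem_erase] at hp
  rcases hp with ⟨⟨a, ha, hpa⟩, h⟩ | ⟨⟨a, ha, hpa⟩, h⟩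
  · exact absurd ⟨a, ha.2, hpa⟩ h
  · by_cases hac : a = c
    · exact hac ▸ hpa
    · exact absurd ⟨a, ⟨hac, ha⟩, hpa⟩ h

lemma card_blockUnion_inter_le {n k : ℕ} (D : Finset (ℕ × ℕ)) (F : Finset (Fin n × Fin n)) :
    (blockUnion n k D ∩ F).card ≤ ∑ c ∈ D, (block n k c ∩ F).card := by
  rw [blockUnion, Finset.biUnion_inter]
  exact Finset.card_biUnion_le

/-! ### Exact recovery -/

/-- The corners of `m` adjacent blocks in the first rows, with the `j`-th block moved down by one
row (no block is moved if `m ≤ j`). -/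
def shiftedBand (k m j : ℕ) : Finset (ℕ × ℕ) :=
  (Finset.range m).image fun i => (if i = j then 1 else 0, i * k)

lemma mem_blockUnion_shiftedBand {n k m j : ℕ} {p : Fin n × Fin n} :
    p ∈ blockUnion n k (shiftedBand k m j) ↔
      ∃ i < m, p ∈ block n k (if i = j then 1 else 0, i * k) := by
  simp [blockUnion, shiftedBand]

/-- Moving a block down needs `k + 1 ≤ n`, which is where `2 ≤ m` enters. -/
lemma shiftedBand_mem_packings {n k m j : ℕ} (hk : 0 < k) (hm : 2 ≤ m) (hn : m * k ≤ n) :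
    shiftedBand k m j ∈ packings n k m := by
  have h2 : 2 * k ≤ m * k := Nat.mul_le_mul_right k hm
  refine mem_packings.2 ⟨⟨fun c hc => ?_, ?_⟩, fun c hc c' hc' hne => ?_⟩
  · obtain ⟨i, hi, rfl⟩ := Finset.mem_image.1 hc
    have hi' : (i + 1) * k ≤ m * k := Nat.mul_le_mul_right k (Finset.mem_range.1 hi)
    rw [add_mul] at hi'
    rw [mem_corners]
    dsimp only
    split_ifs <;> omega
  · rw [shiftedBand, Finset.card_image_of_injective, Finset.card_range]
    intro i i' h
    exact Nat.eq_of_mul_eq_mul_right hk (congrArg Prod.snd h)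
  · obtain ⟨i, hi, rfl⟩ := Finset.mem_image.1 hc
    obtain ⟨i', hi', rfl⟩ := Finset.mem_image.1 hc'
    rw [Finset.disjoint_left]
    intro p hp hp'
    simp only [mem_block] at hp hp'
    rcases lt_trichotomy i i' with h | h | h
    · have := Nat.mul_le_mul_right k (Nat.succ_le_of_lt h)
      rw [Nat.succ_mul] at this
      omega
    · exact hne (by rw [h])
    · have := Nat.mul_le_mul_right k (Nat.succ_le_of_lt h)
      rw [Nat.succ_mul] at this
      omega

lemma blockUnion_shiftedBand_injOn {n k m : ℕ} (hk : 0 < k) (hn : m * k ≤ n) :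
    Set.InjOn (fun j => blockUnion n k (shiftedBand k m j)) (Finset.range (m + 1)) := by
  have key : ∀ i j, i ≠ j → i < m →
      blockUnion n k (shiftedBand k m i) ≠ blockUnion n k (shiftedBand k m j) := by
    intro i j hij hi h
    have hi' : (i + 1) * k ≤ m * k := Nat.mul_le_mul_right k hi
    rw [add_mul] at hi'
    -- The top left entry of block `i`: its column forces block `i`, and it is uncovered exactly
    -- when that block is shifted.
    let p : Fin n × Fin n := (⟨0, by omega⟩, ⟨i * k, by omega⟩)
    have hp : p ∈ blockUnion n k (shiftedBand k m j) := by
      rw [mem_blockUnion_shiftedBand]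
      exact ⟨i, hi, by rw [mem_block, if_neg hij]; simp [p, hk]⟩
    rw [← h, mem_blockUnion_shiftedBand] at hp
    obtain ⟨l, -, hp⟩ := hp
    simp only [mem_block, p] at hp
    have hl : l = i := by
      rcases lt_trichotomy l i with h | h | h
      · have := Nat.mul_le_mul_right k (Nat.succ_le_of_lt h)
        rw [Nat.succ_mul] at this
        omega
      · exact h
      · have := Nat.mul_le_mul_right k (Nat.succ_le_of_lt h)
        rw [Nat.succ_mul] at this
        omega
    rw [if_pos hl] at hp
    omega
  intro i hi j hj h
  by_contra hij
  rw [Finset.mem_coe, Finset.mem_range] at hi hj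
  by_cases him : i < m
  · exact key i j hij him h
  · exact key j i (Ne.symm hij) (by omega) h.symm

/-- The shift loses row `0` and gains row `k`, within `k` columns. -/
lemma card_symmDiff_shiftedBand_le (n k m j : ℕ) :
    (symmDiff (blockUnion n k (shiftedBand k m m)) (blockUnion n k (shiftedBand k m j))).card
      ≤ 2 * k := by
  refine (Finset.card_le_card (t := (finInterval n 1 0 ∪ finInterval n 1 k) ×ˢ
    finInterval n k (j * k)) fun p hp => ?_).trans ?_
  · rw [Finset.mem_symmDiff, mem_blockUnion_shiftedBand, mem_blockUnion_shiftedBand] at hp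
    rw [Finset.mem_product, Finset.mem_union, mem_finInterval, mem_finInterval, mem_finInterval]
    rcases hp with ⟨⟨i, hi, hpi⟩, h⟩ | ⟨⟨i, hi, hpi⟩, h⟩ <;>
    · by_cases hij : i = j
      · subst hij
        have h' : ¬ _ := fun hx => h ⟨i, hi, hx⟩
        rw [mem_block] at hpi h'
        simp only [hi.ne, ↓reduceIte] at hpi h'
        omega
      · refine absurd ⟨i, hi, ?_⟩ h
        simpa [hij, hi.ne] using hpi
  · rw [Finset.card_product]
    refine Nat.mul_le_mul ((Finset.card_union_le _ _).trans ?_) (card_finInterval_le _ _ _)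
    have h0 := card_finInterval_le n 1 0
    have h1 := card_finInterval_le n 1 k
    omega

/-- Bernoulli's inequality for `m ^ (1 / 10)`. -/
lemma exp_log_div_ten_le {m : ℕ} (hm : 0 < m) {y : ℝ} (hy : y ≤ Real.log m / 10) :
    Real.exp y ≤ 1 + m / 10 := by
  have hm' : (0 : ℝ) < m := by exact_mod_cast hm
  calc Real.exp y ≤ Real.exp (Real.log m * (1 / 10)) := Real.exp_le_exp.2 (by linarith)
    _ = (1 + (m - 1 : ℝ)) ^ (1 / 10 : ℝ) := by rw [add_sub_cancel, Real.rpow_def_of_pos hm']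
    _ ≤ 1 + 1 / 10 * (m - 1 : ℝ) :=
        rpow_one_add_le_one_add_mul_self (by linarith) (by norm_num) (by norm_num)
    _ ≤ 1 + m / 10 := by linarith

/-- A test among `M` planted sets close to a reference set succeeds with small probability. -/
lemma sum_plantedLaw_real_eq_le {n : ℕ} {lam t y : ℝ} (ht : 0 < t) {I : Finset ℕ}
    {K₀ : Finset (Fin n × Fin n)} {K : ℕ → Finset (Fin n × Fin n)} (hinj : Set.InjOn K I)
    (hK : ∀ j ∈ I, Real.exp (6 * (lam ^ 2 * (symmDiff K₀ (K j)).card)) ≤ y)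
    {Khat : (Fin n × Fin n → ℝ) → Finset (Fin n × Fin n)} (hKhat : IsEstimator Khat) :
    ∑ j ∈ I, (plantedLaw lam (K j)).real {X | Khat X = K j} ≤
      3 * t / 4 + I.card * (y / (4 * t ^ 3)) := by
  have hmeas : ∀ j, MeasurableSet {X | Khat X = K j} := fun j =>
    hKhat (MeasurableSpace.measurableSet_top (s := {K j}))
  have hdisj : ∑ j ∈ I, (plantedLaw lam K₀).real {X | Khat X = K j} ≤ 1 := by
    rw [← measureReal_biUnion_finset (fun i hi j hj hij => ?_) fun j _ => hmeas j]
    · exact measureReal_le_one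
    · refine Set.disjoint_left.2 fun X hX hX' => hij (hinj hi hj ?_)
      exact Eq.trans (Eq.symm hX) hX'
  calc _ ≤ ∑ j ∈ I, (3 * t / 4 * (plantedLaw lam K₀).real {X | Khat X = K j} +
        y / (4 * t ^ 3)) := by
        refine Finset.sum_le_sum fun j hj => (plantedLaw_real_le_young (K := K₀) ht
          (hmeas j)).trans ?_
        have := hK j hj
        gcongr
    _ ≤ _ := by
        rw [Finset.sum_add_distrib, ← Finset.mul_sum, Finset.sum_const, nsmul_eq_mul]
        have := mul_le_mul_of_nonneg_left hdisj (by positivity : 0 ≤ 3 * t / 4)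
        linarith

lemma error_probability_ge {n k m : ℕ} {lam : ℝ} (hk : 0 < k) (hm : 0 < m) (hn : m * k ≤ n)
    (hlam : 0 < lam) (hlt : lam < 1 / 11 * √(Real.log m / k))
    {Khat : (Fin n × Fin n → ℝ) → Finset (Fin n × Fin n)} (hKhat : IsEstimator Khat) :
    ENNReal.ofReal 0.54 ≤
      ⨆ K ∈ consecutiveFamily n k m, plantedLaw lam K {X | Khat X ≠ K} := by
  -- For `m = 1` the logarithm vanishes and no positive `lam` is admissible.
  have hm2 : 2 ≤ m := by
    by_contra h
    obtain rfl : m = 1 := by omega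
    simp only [Nat.cast_one, Real.log_one, zero_div, Real.sqrt_zero, mul_zero] at hlt
    linarith
  have hk' : (0 : ℝ) < k := by exact_mod_cast hk
  have hm' : (2 : ℝ) ≤ m := by exact_mod_cast hm2
  have hlog : 0 ≤ Real.log m := Real.log_nonneg (by linarith)
  have hlk : lam ^ 2 * k ≤ Real.log m / 121 := by
    have h1 : lam ^ 2 ≤ (1 / 11 * √(Real.log m / k)) ^ 2 := by gcongr
    rw [mul_pow, Real.sq_sqrt (by positivity)] at h1
    calc lam ^ 2 * k ≤ ((1 / 11) ^ 2 * (Real.log m / k)) * k := by gcongr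
      _ = Real.log m / 121 := by field_simp; ring
  by_contra! hlt'
  set K : ℕ → Finset (Fin n × Fin n) := fun j => blockUnion n k (shiftedBand k m j) with hKdef
  have hbig : ∀ j ∈ Finset.range (m + 1), 0.46 ≤ (plantedLaw lam (K j)).real {X | Khat X = K j} := by
    intro j _
    have hmem : K j ∈ consecutiveFamily n k m := by
      rw [consecutiveFamily_eq_image hk]
      exact Finset.mem_image_of_mem _ (shiftedBand_mem_packings hk hm2 hn)
    have h1 : plantedLaw lam (K j) {X | Khat X ≠ K j} < ENNReal.ofReal 0.54 :=
      (le_iSup₂ (f := fun K (_ : K ∈ consecutiveFamily n k m) =>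
        plantedLaw lam K {X | Khat X ≠ K}) _ hmem).trans_lt hlt'
    have h2 : (plantedLaw lam (K j)).real {X | Khat X ≠ K j} ≤ 0.54 :=
      ENNReal.toReal_le_of_le_ofReal (by norm_num) h1.le
    have hms : MeasurableSet {X | Khat X = K j} :=
      hKhat (MeasurableSpace.measurableSet_top (s := {K j}))
    have h3 := probReal_compl_eq_one_sub (μ := plantedLaw lam (K j)) hms
    have h4 : {X | Khat X = K j}ᶜ = {X | Khat X ≠ K j} := rfl
    rw [h4] at h3
    linarith
  -- The unshifted band `j = m` is both reference and hypothesis. It is needed at `m = 2`, since two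
  -- hypotheses alone cannot force an error above `1 / 2`. With `t = 0.45 * (m + 1)` the bound per
  -- hypothesis is at most `0.3375 + 0.122 < 0.46`; exponent two in Young's inequality would give no
  -- better than `1 / √3` at `m = 2`. The constant `1 / 11` ensures `12 * lam ^ 2 * k ≤ (12 / 121) *
  -- log m ≤ log m / 10`.
  have hupper := sum_plantedLaw_real_eq_le (lam := lam) (t := (m + 1) * 0.45) (y := 1 + m / 10)
    (by positivity) (blockUnion_shiftedBand_injOn hk hn) (K₀ := K m) (fun j _ => by
      refine exp_log_div_ten_le hm ?_
      have hc : ((symmDiff (K m) (K j)).card : ℝ) ≤ 2 * k := by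
        exact_mod_cast card_symmDiff_shiftedBand_le n k m j
      have := mul_le_mul_of_nonneg_left hc (sq_nonneg lam)
      change 6 * (lam ^ 2 * ((symmDiff (K m) (K j)).card : ℝ)) ≤ _
      linarith) hKhat
  have hlower := Finset.card_nsmul_le_sum _ _ _ hbig
  have hlt2 := hlower.trans hupper
  rw [Finset.card_range, nsmul_eq_mul] at hlt2
  push_cast at hlt2
  have hM : (m + 1 : ℝ) * ((1 + m / 10) / (4 * ((m + 1) * 0.45) ^ 3)) ≤ 0.122 * (m + 1) := by
    rw [mul_comm]
    gcongr
    rw [div_le_iff₀ (by positivity)]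
    nlinarith [mul_nonneg (sub_nonneg.2 hm') (sub_nonneg.2 hm'),
      mul_nonneg (mul_nonneg (sub_nonneg.2 hm') (sub_nonneg.2 hm')) (sub_nonneg.2 hm')]
  linarith

/-! ### Correlated recovery -/

lemma measurable_comp_estimator {n : ℕ} {Khat : (Fin n × Fin n → ℝ) → Finset (Fin n × Fin n)}
    (hKhat : IsEstimator Khat) (g : Finset (Fin n × Fin n) → ℝ) :
    Measurable fun X => g (Khat X) :=
  fun s _ => hKhat (MeasurableSpace.measurableSet_top (s := g ⁻¹' s))

lemma integrable_comp_estimator {n : ℕ} {Khat : (Fin n × Fin n → ℝ) → Finset (Fin n × Fin n)}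
    (hKhat : IsEstimator Khat) (g : Finset (Fin n × Fin n) → ℝ) (lam : ℝ)
    (K : Finset (Fin n × Fin n)) : Integrable (fun X => g (Khat X)) (plantedLaw lam K) :=
  Integrable.of_bound (measurable_comp_estimator hKhat g).aestronglyMeasurable
    (∑ F, ‖g F‖) (ae_of_all _ fun _ =>
      Finset.single_le_sum (f := fun F => ‖g F‖) (fun _ _ => norm_nonneg _) (Finset.mem_univ _))

lemma overlap_nonneg {n : ℕ} (lam : ℝ) (K : Finset (Fin n × Fin n))
    (Khat : (Fin n × Fin n → ℝ) → Finset (Fin n × Fin n)) : 0 ≤ overlap lam K Khat :=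
  integral_nonneg fun _ => Nat.cast_nonneg _

/-- Each block of the planted set contributes to the overlap hardly more than it would if it were
not planted. -/
lemma overlap_blockUnion_le {n k : ℕ} {lam : ℝ} (hk : 0 < k) (hlam : 0 < lam) (hkl : k * lam ≤ 1)
    {Khat : (Fin n × Fin n → ℝ) → Finset (Fin n × Fin n)} (hKhat : IsEstimator Khat)
    (D : Finset (ℕ × ℕ)) :
    overlap lam (blockUnion n k D) Khat ≤
      ∑ c ∈ D, (∫ X, ((block n k c ∩ Khat X).card : ℝ)
        ∂(plantedLaw lam (blockUnion n k (D.erase c))) + k ^ 2 * (2 * (k * lam))) := by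
  have hk' : (0 : ℝ) < k := by exact_mod_cast hk
  have hint := integrable_comp_estimator hKhat
  calc overlap lam (blockUnion n k D) Khat
      ≤ ∫ X, ∑ c ∈ D, ((block n k c ∩ Khat X).card : ℝ)
          ∂(plantedLaw lam (blockUnion n k D)) := by
        refine integral_mono (hint (fun F => ((blockUnion n k D ∩ F).card : ℝ)) _ _)
          (hint (fun F => ∑ c ∈ D, ((block n k c ∩ F).card : ℝ)) _ _) fun X => ?_
        dsimp only
        rw [← Nat.cast_sum]
        exact Nat.cast_le.2 (card_blockUnion_inter_le D (Khat X))
    _ = ∑ c ∈ D, ∫ X, ((block n k c ∩ Khat X).card : ℝ)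
          ∂(plantedLaw lam (blockUnion n k D)) :=
        integral_finsetSum _ fun c _ => hint (fun F => ((block n k c ∩ F).card : ℝ)) _ _
    _ ≤ _ := by
        -- Change of measure with `t = k * lam`, since deleting a block alters at most `k ^ 2`
        -- entries.
        refine Finset.sum_le_sum fun c _ => integral_plantedLaw_le_add (by positivity) hkl ?_
          (measurable_comp_estimator hKhat fun F => ((block n k c ∩ F).card : ℝ))
          (fun X => Nat.cast_nonneg _) fun X => ?_
        · have : ((symmDiff (blockUnion n k (D.erase c)) (blockUnion n k D)).card : ℝ) ≤
              (k : ℝ) ^ 2 := by exact_mod_cast card_symmDiff_blockUnion_erase_le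
          rw [mul_pow, mul_comm]
          gcongr
        · exact_mod_cast (Finset.card_le_card Finset.inter_subset_left).trans (card_block_le n k c)

lemma sum_freeCorners_integral_le {n k s : ℕ} {lam : ℝ}
    {Khat : (Fin n × Fin n → ℝ) → Finset (Fin n × Fin n)} (hKhat : IsEstimator Khat)
    (hcard : ∀ X, (Khat X).card ≤ s) (E : Finset (ℕ × ℕ)) :
    ∑ c ∈ freeCorners n k E, ∫ X, ((block n k c ∩ Khat X).card : ℝ)
      ∂(plantedLaw lam (blockUnion n k E)) ≤ s * k ^ 2 := by
  have hint := integrable_comp_estimator hKhat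
  rw [← integral_finsetSum _ fun c _ => hint (fun F => ((block n k c ∩ F).card : ℝ)) _ _]
  calc _ ≤ ∫ X, (s * k ^ 2 : ℝ) ∂(plantedLaw lam (blockUnion n k E)) := by
        refine integral_mono
          (hint (fun F => ∑ c ∈ freeCorners n k E, ((block n k c ∩ F).card : ℝ)) _ _)
          (integrable_const _) fun X => ?_
        exact_mod_cast (sum_card_block_inter_le n k _ (Khat X)).trans
          (Nat.mul_le_mul_right _ (hcard X))
    _ = _ := by simp

/-- As `m * k ≤ n`, the excluded corners number at most `4 * n * k`, which is small against `n ^ 2`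
once `100 * k ≤ n`. -/
lemma half_sq_le_card_freeCorners {n k m : ℕ} (hk : 0 < k) (hn : (m + 1) * k ≤ n)
    (hkn : 100 * k ≤ n) {E : Finset (ℕ × ℕ)} (hE : E.card = m) :
    (n : ℝ) ^ 2 / 2 ≤ (freeCorners n k E).card := by
  have h := card_freeCorners_ge (n := n) hk E
  rw [hE] at h
  have h' : ((n + 1 - k : ℕ) : ℝ) ^ 2 ≤ (freeCorners n k E).card + m * (2 * k) ^ 2 := by
    exact_mod_cast h
  rw [Nat.cast_sub (by omega)] at h'
  push_cast at h'
  have hn' : ((m : ℝ) + 1) * k ≤ n := by exact_mod_cast hn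
  have hkn' : 100 * (k : ℝ) ≤ n := by exact_mod_cast hkn
  have hk' : (0 : ℝ) < k := by exact_mod_cast hk
  have h1 : (m : ℝ) * (2 * k) ^ 2 ≤ 4 * (n * k) := by nlinarith
  have h2 : (n : ℝ) * (100 * k) ≤ n * n := by gcongr
  nlinarith

/-- The overlap averaged over all planted sets, non-asymptotically. -/
lemma expect_overlap_le {n k m : ℕ} {lam : ℝ} (hk : 0 < k) (hm : 0 < m) (hn : m * k ≤ n)
    (hkn : 100 * k ≤ n) (hlam : 0 < lam) (hkl : k * lam ≤ 1)
    {Khat : (Fin n × Fin n → ℝ) → Finset (Fin n × Fin n)} (hKhat : IsEstimator Khat)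
    (hcard : ∀ X, (Khat X).card ≤ m * k ^ 2) :
    𝔼 K ∈ consecutiveFamily n k m, overlap lam K Khat ≤
      (2 * (k / n) + 2 * (k * lam)) * (m * k ^ 2) := by
  obtain ⟨m, rfl⟩ : ∃ m', m = m' + 1 := ⟨m - 1, by omega⟩
  have hk' : (0 : ℝ) < k := by exact_mod_cast hk
  have hn0 : (0 : ℝ) < n := by exact_mod_cast (by omega : 0 < n)
  have hn' : ((m : ℝ) + 1) * k ≤ n := by exact_mod_cast hn
  rw [consecutiveFamily_eq_image hk, Finset.expect_image (blockUnion_injOn hk)]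
  rw [Finset.expect_eq_sum_div_card]
  refine div_le_of_le_mul₀ (by positivity) (by positivity) ?_
  set w : ℝ := ((packings n k (m + 1)).card : ℝ) with hw
  set v : ℝ := ((packings n k m).card : ℝ) with hv
  -- Pairs of a packing and one of its blocks are counted by the erase-insert bijection.
  have hcount : v * (n ^ 2 / 2) ≤ (m + 1) * w := by
    have h := sum_packings_erase (M := ℝ) (n := n) (m := m) hk fun _ _ => 1
    simp only [Finset.sum_const, nsmul_eq_mul, mul_one] at h
    have h1 : ∑ D ∈ packings n k (m + 1), (D.card : ℝ) = (m + 1) * w := by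
      rw [Finset.sum_congr rfl fun D hD => by rw [(mem_packings.1 hD).1.2], Finset.sum_const,
        nsmul_eq_mul, mul_comm]
      push_cast
      rfl
    rw [← h1, h, hv, ← nsmul_eq_mul]
    exact Finset.card_nsmul_le_sum _ _ _ fun E hE =>
      half_sq_le_card_freeCorners hk hn hkn (mem_packings.1 hE).1.2
  have hmain : ∑ D ∈ packings n k (m + 1), overlap lam (blockUnion n k D) Khat ≤
      v * ((m + 1) * k ^ 2 * k ^ 2) + w * ((m + 1) * (k ^ 2 * (2 * (k * lam)))) := by
    refine (Finset.sum_le_sum fun D _ => overlap_blockUnion_le hk hlam hkl hKhat D).trans ?_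
    simp_rw [Finset.sum_add_distrib]
    rw [sum_packings_erase hk fun E c =>
      ∫ X, ((block n k c ∩ Khat X).card : ℝ) ∂(plantedLaw lam (blockUnion n k E))]
    refine add_le_add ?_ (le_of_eq ?_)
    · rw [hv, ← nsmul_eq_mul]
      refine Finset.sum_le_card_nsmul _ _ _ fun E _ => ?_
      have := sum_freeCorners_integral_le (lam := lam) (k := k) hKhat hcard E
      push_cast at this
      exact this
    · simp only [Finset.sum_const, nsmul_eq_mul]
      rw [Finset.sum_congr rfl fun D hD => by rw [(mem_packings.1 hD).1.2], Finset.sum_const,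
        nsmul_eq_mul]
      push_cast
      rfl
  refine hmain.trans ?_
  have hv' : v ≤ (m + 1) * w * 2 / n ^ 2 := by
    rw [le_div_iff₀ (by positivity)]; linarith
  have hw0 : 0 ≤ w := Nat.cast_nonneg _
  -- One factor `(m + 1) * k ≤ n` cancels one of the two powers of `n`.
  have h3 : v * ((m + 1) * k ^ 2 * k ^ 2) ≤ 2 * (k / n) * ((m + 1) * k ^ 2) * w := by
    calc v * ((m + 1) * k ^ 2 * k ^ 2)
        ≤ (m + 1) * w * 2 / n ^ 2 * ((m + 1) * k ^ 2 * k ^ 2) := by gcongr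
      _ = 2 * w * (m + 1) * k ^ 3 / n ^ 2 * ((m + 1) * k) := by ring
      _ ≤ 2 * w * (m + 1) * k ^ 3 / n ^ 2 * n := by gcongr
      _ = _ := by field_simp
  push_cast
  linarith

lemma iInf_le_expect {α : Type*} (s : Finset α) (f : α → ℝ) (hf : ∀ a, 0 ≤ f a) :
    ⨅ a : s, f a ≤ 𝔼 a ∈ s, f a := by
  rcases s.eq_empty_or_nonempty with rfl | hs
  · simp
  · exact Finset.le_expect hs fun a ha => ciInf_le
      (f := fun a : s => f a) ⟨0, by rintro _ ⟨a, rfl⟩; exact hf a⟩ ⟨a, ha⟩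

lemma isLittleO_expect_overlap {k m : ℕ → ℕ} {lam : ℕ → ℝ}
    (h : ∀ᶠ n in atTop, 0 < k n ∧ 0 < m n ∧ m n * k n ≤ n ∧ 0 < lam n)
    (hk : (fun n => (k n : ℝ)) =o[atTop] (fun n => (n : ℝ)))
    (hlam : lam =o[atTop] (fun n => (k n : ℝ)⁻¹))
    {Khat : (n : ℕ) → (Fin n × Fin n → ℝ) → Finset (Fin n × Fin n)}
    (hKhat : ∀ n, IsEstimator (Khat n)) (hcard : ∀ n X, (Khat n X).card ≤ m n * k n ^ 2) :
    (fun n => 𝔼 K ∈ consecutiveFamily n (k n) (m n), overlap (lam n) K (Khat n))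
      =o[atTop] (fun n => (m n : ℝ) * (k n : ℝ) ^ 2) := by
  rw [isLittleO_iff]
  intro ε hε
  filter_upwards [h, isLittleO_iff.1 hk (by norm_num : (0 : ℝ) < 1 / 100),
    isLittleO_iff.1 hk (by positivity : (0 : ℝ) < ε / 4),
    isLittleO_iff.1 hlam (by norm_num : (0 : ℝ) < 1),
    isLittleO_iff.1 hlam (by positivity : (0 : ℝ) < ε / 4)] with n ⟨hk0, hm0, hn, hl0⟩ h1 h2 h3 h4
  have hk' : (0 : ℝ) < k n := by exact_mod_cast hk0
  have hn0 : (0 : ℝ) < n := by exact_mod_cast (Nat.mul_pos hm0 hk0).trans_le hn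
  simp only [Real.norm_natCast, norm_inv, Real.norm_of_nonneg hl0.le] at h1 h2 h3 h4
  have hkn : 100 * k n ≤ n := by
    have : 100 * (k n : ℝ) ≤ n := by linarith
    exact_mod_cast this
  have hkl : ∀ {e : ℝ}, lam n ≤ e * (k n : ℝ)⁻¹ → k n * lam n ≤ e := by
    intro e he
    calc k n * lam n ≤ k n * (e * (k n : ℝ)⁻¹) := by gcongr
      _ = e := by field_simp
  have hE := expect_overlap_le hk0 hm0 hn hkn hl0 (hkl h3) (hKhat n) (hcard n)
  rw [Real.norm_of_nonneg (Finset.expect_nonneg fun K _ => overlap_nonneg _ _ _),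
    Real.norm_of_nonneg (by positivity)]
  refine hE.trans ?_
  gcongr
  have h5 : (k n : ℝ) / n ≤ ε / 4 := by rw [div_le_iff₀ hn0]; exact h2
  linarith [hkl h4]

theorem theorem5 :
    -- exact recovery
    (∃ C : ℝ, 0 < C ∧
      ∀ (n k m : ℕ) (lam : ℝ), 0 < k → 0 < m → m * k ≤ n → 0 < lam →
        lam < C * √(Real.log m / k) →
        (1 / 2 : ℝ≥0∞) <
          ⨅ (Khat : (Fin n × Fin n → ℝ) → Finset (Fin n × Fin n)) (_ : IsEstimator Khat),
            ⨆ K ∈ consecutiveFamily n k m, plantedLaw lam K {X | Khat X ≠ K}) ∧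
    -- correlated recovery
    (∀ (k m : ℕ → ℕ) (lam : ℕ → ℝ),
      (∀ᶠ n in atTop, 0 < k n ∧ 0 < m n ∧ m n * k n ≤ n ∧ 0 < lam n) →
      (fun n => (k n : ℝ)) =o[atTop] (fun n => (n : ℝ)) →
      lam =o[atTop] (fun n => (k n : ℝ)⁻¹) →
      ∀ Khat : (n : ℕ) → (Fin n × Fin n → ℝ) → Finset (Fin n × Fin n),
        (∀ n, IsEstimator (Khat n)) →
        (∀ n X, (Khat n X).card ≤ m n * k n ^ 2) →
        -- the overlap averaged over a uniformly random planted set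
        ((fun n => 𝔼 K ∈ consecutiveFamily n (k n) (m n), overlap (lam n) K (Khat n))
          =o[atTop] (fun n => (m n : ℝ) * (k n : ℝ) ^ 2)) ∧
        -- the worst-case overlap
        ((fun n => ⨅ K : consecutiveFamily n (k n) (m n), overlap (lam n) K (Khat n))
          =o[atTop] (fun n => (m n : ℝ) * (k n : ℝ) ^ 2))) := by
  refine ⟨⟨1 / 11, by norm_num, fun n k m lam hk hm hn hlam hlt => ?_⟩,
    fun k m lam h hk hlam Khat hKhat hcard => ?_⟩
  -- The margin `0.54` keeps the inequality strict after the infimum over estimators.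
  · refine lt_of_lt_of_le ?_ (le_iInf₂ fun Khat hKhat =>
      error_probability_ge hk hm hn hlam hlt hKhat)
    have : (1 / 2 : ℝ≥0∞) = ENNReal.ofReal (1 / 2) := by
      rw [ENNReal.ofReal_div_of_pos two_pos]; simp
    rw [this]
    exact (ENNReal.ofReal_lt_ofReal_iff (by norm_num)).2 (by norm_num)
  · have hE := isLittleO_expect_overlap h hk hlam hKhat hcard
    refine ⟨hE, IsBigO.trans_isLittleO (IsBigO.of_bound 1 (Eventually.of_forall fun n => ?_)) hE⟩
    rw [one_mul, Real.norm_of_nonneg (Real.iInf_nonneg fun K => overlap_nonneg _ _ _)]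
    have h := iInf_le_expect (consecutiveFamily n (k n) (m n))
      (fun K => overlap (lam n) K (Khat n)) fun K => overlap_nonneg _ _ _
    exact h.trans (le_abs_self _)
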